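/- Fix integers $d\ge 2$ and $n\ge d$. For a nonempty finite action set $\mathcal S\subset\{0,1\}^d$, consider the full-information game with $n$ rounds: in round $t$ the forecaster draws an action $V_t\in\mathcal S$ at random from a distribution that may depend on the past actions and past loss vectors; simultaneously the adversary, possibly randomized and adaptive, selects a loss vector $\ell_t\in[0,+\infty)^d$; the forecaster incurs the loss $\ell_t^{T}V_t$ and observes $\ell_t$. An $L_\infty$ adversary is one with $\|\ell_t\|_\infty\le 1$ for all $t$. The regret is $$\overline R_n=\mathbb E\sum_{t=1}^n \ell_t^{T}V_t-\min_{u\in\mathcal S}\mathbb E\sum_{t=1}^n\ell_t^{T}u .$$ The exp2 forecaster on $\mathcal S$ with learning rate $\eta$ draws $V_t$ from the distribution $(w_{v,t})_{v\in\mathcal S}$, where $w_{v,1}=1/|\mathcal S|$ and $$w_{v,t+1}=\frac{\exp(-\eta\,\ell_t^{T}v)\,w_{v,t}}{\sum_{u\in\mathcal S}\exp(-\eta\,\ell_t^{T}u)\,w_{u,t}} .$$ There is a nonempty set $\mathcal S\subset\{0,1\}^d$ such that, for every $\eta\in\mathbb R$ (in particular for every $\eta>0$), the exp2 forecaster on $\mathcal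 S$ with learning rate $\eta$ satisfies $$\sup \overline R_n\ \ge\ 0.02\, d^{3/2}\sqrt n ,$$ where the supremum is over all $L_\infty$ adversaries. Moreover exp2 is suboptimal on $\mathcal S$ against $L_\infty$ adversaries by a factor of order $\sqrt d$: the minimax regret on the same set satisfies $$\inf\,\sup \overline R_n\ \le\ d\sqrt{2n},$$ where the infimum is over all forecasters for the full-information game on $\mathcal S$ and the supremum is over all $L_\infty$ adversaries. -/

import Mathlib

namespace CombGame

/-- The vertices of the hypercube `{0,1}^d`. -/
abbrev Vertex (d : ℕ) : Type := Fin d → Bool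

/-- The loss `ℓᵀ v` of the action `v` when the loss vector is `ℓ`. -/
def lossOf {d : ℕ} (ℓ : Fin d → ℝ) (v : Vertex d) : ℝ := ∑ i, if v i then ℓ i else 0

/-- A randomized forecaster for the full information game with action set `S`. Once `t` rounds
have been played, `prob t V ℓ v` is the conditional probability that the next action is `v ∈ S`,
given the past actions `V` of the forecaster and the past loss vectors `ℓ`, all of which he has
observed. -/
structure Forecaster {d : ℕ} (S : Finset (Vertex d)) where
  prob : (t : ℕ) → (Fin t → Vertex d) → (Fin t → Fin d → ℝ) → Vertex d → ℝ
  prob_nonneg : ∀ t V ℓ, ∀ v ∈ S, 0 ≤ prob t V ℓ v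
  sum_prob : ∀ t V ℓ, ∑ v ∈ S, prob t V ℓ v = 1
  measurable_prob : ∀ t V, ∀ v ∈ S, Measurable fun ℓ => prob t V ℓ v

/-- An adversary satisfying the `L_∞` assumption, randomized and adaptive. He draws a seed
`ω` in a probability space at the start; once `t` rounds have been played he chooses the loss
vector `loss ω t V ∈ [0,1]^d` from the seed and the past actions `V` of the forecaster, so that he
does not see the action played in the current round. Earlier loss vectors are themselves functions
of `ω` and of the past actions. -/
structure Adversary (d : ℕ) where
  Ω : Type
  [mΩ : MeasurableSpace Ω]
  μ : MeasureTheory.Measure Ω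
  [isProb : MeasureTheory.IsProbabilityMeasure μ]
  loss : Ω → (t : ℕ) → (Fin t → Vertex d) → Fin d → ℝ
  measurable_loss : ∀ t V, Measurable fun ω => loss ω t V
  loss_nonneg : ∀ ω t V i, 0 ≤ loss ω t V i
  loss_le_one : ∀ ω t V i, loss ω t V i ≤ 1

attribute [instance] Adversary.mΩ Adversary.isProb

section
variable {d : ℕ} {S : Finset (Vertex d)}

theorem Forecaster.nonempty (F : Forecaster S) : S.Nonempty := by
  rw [Finset.nonempty_iff_ne_empty]
  rintro rfl
  simpa using F.sum_prob 0 Fin.elim0 Fin.elim0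

/-- Let the loss vectors be chosen by the rule `a` (a function of the past actions), and suppose
that `t` rounds have been played, with actions `V` and loss vectors `ℓ`. Then
`F.expectedSum a g k t V ℓ` is the conditional expectation, over the forecaster's randomization,
of the sum over the next `k` rounds of `g (action) (loss vector)`. -/
noncomputable def Forecaster.expectedSum (F : Forecaster S)
    (a : (t : ℕ) → (Fin t → Vertex d) → Fin d → ℝ) (g : Vertex d → (Fin d → ℝ) → ℝ) :
    (k t : ℕ) → (Fin t → Vertex d) → (Fin t → Fin d → ℝ) → ℝ
  | 0, _, _, _ => 0
  | k + 1, t, V, ℓ =>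
      ∑ v ∈ S, F.prob t V ℓ v * (g v (a t V) +
        F.expectedSum a g k (t + 1) (Fin.snoc (α := fun _ => Vertex d) V v)
          (Fin.snoc (α := fun _ => Fin d → ℝ) ℓ (a t V)))

/-- The expectation, over the adversary's and the forecaster's randomization, of the sum over
the first `n` rounds of `g (action) (loss vector)`. -/
noncomputable def expectation (F : Forecaster S) (A : Adversary d) (n : ℕ)
    (g : Vertex d → (Fin d → ℝ) → ℝ) : ℝ :=
  ∫ ω, F.expectedSum (A.loss ω) g n 0 Fin.elim0 Fin.elim0 ∂A.μ

/-- The regret `E ∑_{t ≤ n} ℓ_tᵀ V_t - min_{u ∈ S} E ∑_{t ≤ n} ℓ_tᵀ u`. -/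
noncomputable def regret (F : Forecaster S) (A : Adversary d) (n : ℕ) : ℝ :=
  expectation F A n (fun v ℓ => lossOf ℓ v) -
    S.inf' F.nonempty (fun u => expectation F A n (fun _ ℓ => lossOf ℓ u))

/-- The supremum of the regret over all `L_∞` adversaries. -/
noncomputable def supRegret (F : Forecaster S) (n : ℕ) : EReal :=
  ⨆ A : Adversary d, (regret F A n : EReal)

/-- The minimax regret of the full information game with action set `S` against `L_∞`
adversaries. -/
noncomputable def minimaxRegret (S : Finset (Vertex d)) (n : ℕ) : EReal :=
  ⨅ F : Forecaster S, supRegret F n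

/-- The weight of the vertex `v` in the exp2 forecaster with learning rate `η` after `t` rounds with
loss vectors `ℓ`: uniform over `S` at the start, then updated multiplicatively by `exp (-η ℓ_tᵀ v)`
and normalized over `S`. -/
noncomputable def exp2Weight (S : Finset (Vertex d)) (η : ℝ) :
    (t : ℕ) → (Fin t → Fin d → ℝ) → Vertex d → ℝ
  | 0, _, _ => 1 / (S.card : ℝ)
  | t + 1, ℓ, v =>
      Real.exp (-η * lossOf (ℓ (Fin.last t)) v) * exp2Weight S η t (fun s => ℓ s.castSucc) v /
        ∑ u ∈ S, Real.exp (-η * lossOf (ℓ (Fin.last t)) u) *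
          exp2Weight S η t (fun s => ℓ s.castSucc) u

theorem exp2Weight_pos (hS : S.Nonempty) (η : ℝ) (t : ℕ) (ℓ : Fin t → Fin d → ℝ) (v : Vertex d) :
    0 < exp2Weight S η t ℓ v := by
  induction t generalizing v with
  | zero =>
    have : 0 < S.card := hS.card_pos
    simp only [exp2Weight]
    positivity
  | succ t ih =>
    simp only [exp2Weight]
    exact div_pos (mul_pos (Real.exp_pos _) (ih _ _))
      (Finset.sum_pos (fun u _ => mul_pos (Real.exp_pos _) (ih _ _)) hS)

theorem sum_exp2Weight (hS : S.Nonempty) (η : ℝ) (t : ℕ) (ℓ : Fin t → Fin d → ℝ) :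
    ∑ v ∈ S, exp2Weight S η t ℓ v = 1 := by
  cases t with
  | zero =>
    have : (S.card : ℝ) ≠ 0 := by exact_mod_cast hS.card_pos.ne'
    simp [exp2Weight, this]
  | succ t =>
    simp only [exp2Weight]
    rw [← Finset.sum_div]
    exact div_self (Finset.sum_pos (fun u _ => mul_pos (Real.exp_pos _)
      (exp2Weight_pos hS η t _ u)) hS).ne'

theorem measurable_lossOf (v : Vertex d) : Measurable fun ℓ : Fin d → ℝ => lossOf ℓ v := by
  unfold lossOf
  refine Finset.measurable_sum _ fun i _ => ?_
  split_ifs <;> fun_prop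

theorem measurable_exp2Weight (S : Finset (Vertex d)) (η : ℝ) (t : ℕ) (v : Vertex d) :
    Measurable fun ℓ => exp2Weight S η t ℓ v := by
  induction t generalizing v with
  | zero => simp only [exp2Weight]; fun_prop
  | succ t ih =>
    simp only [exp2Weight]
    have h : ∀ u : Vertex d, Measurable fun ℓ : Fin (t + 1) → Fin d → ℝ =>
        Real.exp (-η * lossOf (ℓ (Fin.last t)) u) *
          exp2Weight S η t (fun s => ℓ s.castSucc) u := fun u =>
      (Real.measurable_exp.comp
        (((measurable_lossOf u).comp (measurable_pi_apply (Fin.last t))).const_mul (-η))).mul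
        ((ih u).comp (measurable_pi_lambda _ fun s => measurable_pi_apply s.castSucc))
    exact (h v).div (Finset.measurable_sum _ fun u _ => h u)

/-- The exp2 forecaster with learning rate `η` in the full information game. -/
noncomputable def exp2 (S : Finset (Vertex d)) (hS : S.Nonempty) (η : ℝ) : Forecaster S where
  prob t _ ℓ v := exp2Weight S η t ℓ v
  prob_nonneg t _ ℓ v _ := (exp2Weight_pos hS η t ℓ v).le
  sum_prob t _ ℓ := sum_exp2Weight hS η t ℓ
  measurable_prob t _ v _ := measurable_exp2Weight S η t v

end

end CombGame

/-!
Write `k = ⌊(d + 1) / 3⌋`. The action set `coupledBlocks k i₀` consists of the vertices whose first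
`k` coordinates are all equal to some `b`, whose next `k` coordinates are all equal to `!b`, and
whose remaining coordinates are arbitrary. It is a hypercube parametrized by `c = d + 1 - 2 k` free
coordinates, one of which, `i₀ = 0`, carries the two blocks with it.

*Lower bound.* For oblivious losses the weights of exp2 are the normalized exponentials of the
cumulative losses. Flipping a free coordinate, together with its block, is an involution of the
action set, so the probability that exp2 plays this coordinate is a logistic function of the
cumulative loss difference (`exp2Mean_coord`). Two adversaries are played off against each other.
Losses alternating between the two blocks make exp2 overreact
(`alternating_le_supRegret_exp2`): the regret is at least `n k (1 / 2 - 1 / (1 + exp (η k))) / 2`,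
which is of order `n k ^ 2 η` when `η k ≤ 2` and of order `n k` beyond. A constant loss on the free
coordinates makes it react too slowly (`constant_le_supRegret_exp2`): the regret is at least
`c / (4 η)` when `η n ≥ 1`, and at least `n c / 4` otherwise, negative `η` included. The product of
`n k ^ 2 η / 16` and `c / (4 η)` does not depend on `η` and has order `n d ^ 3`, so one of the two
has order `d ^ (3 / 2) √n`. In the other regimes the regret has order `d n`, and
`d n ≥ d ^ (3 / 2) √n` because `n ≥ d`.

*Upper bound.* Projected gradient descent has regret at most `D ^ 2 / (2 η) + n η G ^ 2 / 2` for
the diameter `D` of the feasible set and a bound `G` on the norms of the losses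
(`inner_le_of_projected_step`). A forecaster needs a distribution over actions that depends
measurably on the past, whereas a point of the convex hull of `S` determines only the mean of such a
distribution. Descent is therefore run on `lift S`, the set of pairs formed by a mean and a
distribution that realizes it: the projection is nonexpansive, so the distribution is a continuous
function of the past losses. The losses act on the mean only, so `G ^ 2 ≤ d`, and the vertices of
`lift S` satisfy `D ^ 2 ≤ d + 2 ≤ 2 d`, whence the bound `d √(2 n)` (`minimaxRegret_le`).
-/

namespace CombGame

section
variable {d : ℕ} {S : Finset (Vertex d)}

/-! ### Exp2 against oblivious losses -/

/-- The unnormalized exponential weight of `v` after `t` rounds with loss vectors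
`L 0, …, L (t - 1)`. -/
noncomputable def cumulativeWeight (η : ℝ) (L : ℕ → Fin d → ℝ) (t : ℕ) (v : Vertex d) : ℝ :=
  Real.exp (-η * ∑ s ∈ Finset.range t, lossOf (L s) v)

theorem cumulativeWeight_pos (η : ℝ) (L : ℕ → Fin d → ℝ) (t : ℕ) (v : Vertex d) :
    0 < cumulativeWeight η L t v :=
  Real.exp_pos _

/-- The normalization of exp2 can be postponed to the last round. -/
theorem exp2Weight_eq_cumulativeWeight (hS : S.Nonempty) (η : ℝ) (L : ℕ → Fin d → ℝ)
    (t : ℕ) (v : Vertex d) :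
    exp2Weight S η t (fun s => L s) v =
      cumulativeWeight η L t v / ∑ u ∈ S, cumulativeWeight η L t u := by
  simp only [cumulativeWeight]
  induction t generalizing v with
  | zero => simp [exp2Weight]
  | succ t ih =>
    have hZ : (0 : ℝ) < ∑ u ∈ S, Real.exp (-η * ∑ s ∈ Finset.range t, lossOf (L s) u) :=
      Finset.sum_pos (fun u _ => Real.exp_pos _) hS
    simp only [exp2Weight, Fin.val_castSucc, Fin.val_last, ih, ← mul_div_assoc,
      ← Finset.sum_div, ← Real.exp_add, ← mul_add, Finset.sum_range_succ]
    rw [div_div_div_cancel_right₀ hZ.ne']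
    simp only [add_comm]

theorem sum_cumulativeWeight_div (hS : S.Nonempty) (η : ℝ) (L : ℕ → Fin d → ℝ) (t : ℕ) :
    ∑ v ∈ S, cumulativeWeight η L t v / ∑ u ∈ S, cumulativeWeight η L t u = 1 := by
  rw [← Finset.sum_div]
  exact div_self (Finset.sum_pos (fun u _ => cumulativeWeight_pos η L t u) hS).ne'

/-- The deterministic oblivious adversary that plays the loss vectors `L 0, L 1, …`. -/
noncomputable def obliviousAdversary (L : ℕ → Fin d → ℝ) (h0 : ∀ t i, 0 ≤ L t i)
    (h1 : ∀ t i, L t i ≤ 1) : Adversary d where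
  Ω := Unit
  μ := MeasureTheory.Measure.dirac ()
  loss _ t _ := L t
  measurable_loss _ _ := measurable_const
  loss_nonneg _ t _ i := h0 t i
  loss_le_one _ t _ i := h1 t i

theorem snoc_prefix {α : Type*} (L : ℕ → α) (t : ℕ) :
    Fin.snoc (α := fun _ => α) (fun s : Fin t => L s) (L t) = fun s : Fin (t + 1) => L s := by
  funext s
  refine Fin.lastCases ?_ (fun s => ?_) s <;> simp

/-- The expectation of `f` at the action that exp2 on `S` plays after `t` rounds with loss vectors
`L 0, …, L (t - 1)`. -/
noncomputable def exp2Mean (S : Finset (Vertex d)) (η : ℝ) (L : ℕ → Fin d → ℝ) (t : ℕ)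
    (f : Vertex d → ℝ) : ℝ :=
  ∑ v ∈ S, cumulativeWeight η L t v / (∑ u ∈ S, cumulativeWeight η L t u) * f v

theorem exp2Mean_const (hS : S.Nonempty) (η : ℝ) (L : ℕ → Fin d → ℝ) (t : ℕ) (c : ℝ) :
    exp2Mean S η L t (fun _ => c) = c := by
  rw [exp2Mean, ← Finset.sum_mul, sum_cumulativeWeight_div hS, one_mul]

theorem expectedSum_exp2 (hS : S.Nonempty) (η : ℝ) (L : ℕ → Fin d → ℝ)
    (g : Vertex d → (Fin d → ℝ) → ℝ) (k t : ℕ) (V : Fin t → Vertex d) :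
    (exp2 S hS η).expectedSum (fun t _ => L t) g k t V (fun s => L s) =
      ∑ r ∈ Finset.range k, exp2Mean S η L (t + r) (fun v => g v (L (t + r))) := by
  simp only [exp2Mean]
  induction k generalizing t with
  | zero => simp [Forecaster.expectedSum]
  | succ k ih =>
    simp only [Forecaster.expectedSum, snoc_prefix, ih]
    rw [Finset.sum_range_succ']
    simp only [exp2, exp2Weight_eq_cumulativeWeight hS, mul_add, Finset.sum_add_distrib,
      ← Finset.sum_mul, sum_cumulativeWeight_div hS, one_mul, add_zero]
    rw [add_comm]
    simp only [add_assoc, add_comm 1]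

theorem expectation_exp2_obliviousAdversary (hS : S.Nonempty) (η : ℝ) (n : ℕ)
    (L : ℕ → Fin d → ℝ) (h0 : ∀ t i, 0 ≤ L t i) (h1 : ∀ t i, L t i ≤ 1)
    (g : Vertex d → (Fin d → ℝ) → ℝ) :
    expectation (exp2 S hS η) (obliviousAdversary L h0 h1) n g =
      ∑ t ∈ Finset.range n, exp2Mean S η L t (fun v => g v (L t)) := by
  have h := expectedSum_exp2 hS η L g n 0 Fin.elim0
  simp only [zero_add] at h
  rw [← h]
  have e : (fun s : Fin 0 => L s) = Fin.elim0 := funext fun s => s.elim0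
  rw [e]
  exact @MeasureTheory.integral_dirac Unit ℝ _ _ _ _ _ _ _

/-- The regret of exp2 against a deterministic oblivious adversary is at least its excess loss over
any fixed action. -/
theorem sum_le_supRegret_exp2 (hS : S.Nonempty) (η : ℝ) (n : ℕ) (L : ℕ → Fin d → ℝ)
    (h0 : ∀ t i, 0 ≤ L t i) (h1 : ∀ t i, L t i ≤ 1) {u : Vertex d} (hu : u ∈ S) :
    ((∑ t ∈ Finset.range n, (exp2Mean S η L t (lossOf (L t)) - lossOf (L t) u) : ℝ) : EReal) ≤
      supRegret (exp2 S hS η) n := by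
  have key := expectation_exp2_obliviousAdversary hS η n L h0 h1
  generalize obliviousAdversary L h0 h1 = A at key
  refine le_trans (EReal.coe_le_coe_iff.2 ?_)
    (le_iSup (fun A : Adversary d => (regret (exp2 S hS η) A n : EReal)) A)
  have hinf := Finset.inf'_le (fun u => expectation (exp2 S hS η) A n fun _ ℓ => lossOf ℓ u) hu
  simp only [key, exp2Mean_const hS] at hinf
  rw [regret, Finset.sum_sub_distrib]
  simp only [key, exp2Mean_const hS]
  exact sub_le_sub le_rfl hinf

/-- If an involution `σ` of `S` flips the coordinate `i` and multiplies the weight by `exp (-x)`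
whenever it switches this coordinate on, then the coordinate is on with probability
`1 / (1 + exp x)` under the normalized weights. -/
theorem marginal_eq_of_flip (hS : S.Nonempty) {W : Vertex d → ℝ} (hW : ∀ v, 0 < W v) {i : Fin d}
    (σ : Vertex d → Vertex d) (hσ : ∀ v, σ (σ v) = v) (hσS : ∀ v ∈ S, σ v ∈ S)
    (hσi : ∀ v, σ v i = !v i) {x : ℝ}
    (hx : ∀ v ∈ S, v i = false → W (σ v) = Real.exp (-x) * W v) :
    ∑ v ∈ S, W v / (∑ u ∈ S, W u) * (if v i then 1 else 0) = 1 / (1 + Real.exp x) := by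
  have hZ : 0 < ∑ u ∈ S, W u := Finset.sum_pos (fun u _ => hW u) hS
  have hsplit := Finset.sum_filter_add_sum_filter_not S (fun v => v i = true) W
  have hflip : ∑ v ∈ S with v i = true, W v =
      Real.exp (-x) * ∑ v ∈ S with ¬ v i = true, W v := by
    rw [Finset.mul_sum]
    symm
    refine Finset.sum_nbij' σ σ ?_ ?_ ?_ ?_ ?_ <;>
      simp +contextual [hσ, hσi, hσS, hx]
  have hexp : Real.exp (-x) * Real.exp x = 1 := by rw [← Real.exp_add]; simp
  have hon : ∑ v ∈ S, W v / (∑ u ∈ S, W u) * (if v i then 1 else 0) =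
      (∑ v ∈ S with v i = true, W v) / ∑ u ∈ S, W u := by
    rw [Finset.sum_filter, Finset.sum_div]
    refine Finset.sum_congr rfl fun v _ => ?_
    split_ifs <;> simp
  have hpos := Real.exp_pos x
  rw [hon, div_eq_div_iff hZ.ne' (by positivity)]
  rw [← hsplit, hflip]
  linear_combination (∑ v ∈ S with ¬ v i = true, W v) * hexp

theorem exp2Mean_congr {η : ℝ} {L : ℕ → Fin d → ℝ} {t : ℕ} {f g : Vertex d → ℝ}
    (h : ∀ v ∈ S, f v = g v) : exp2Mean S η L t f = exp2Mean S η L t g :=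
  Finset.sum_congr rfl fun v hv => by rw [h v hv]

theorem exp2Mean_sub (η : ℝ) (L : ℕ → Fin d → ℝ) (t : ℕ) (f g : Vertex d → ℝ) :
    exp2Mean S η L t (fun v => f v - g v) = exp2Mean S η L t f - exp2Mean S η L t g := by
  simp only [exp2Mean, mul_sub, Finset.sum_sub_distrib]

theorem exp2Mean_const_mul (η : ℝ) (L : ℕ → Fin d → ℝ) (t : ℕ) (c : ℝ) (f : Vertex d → ℝ) :
    exp2Mean S η L t (fun v => c * f v) = c * exp2Mean S η L t f := by
  rw [exp2Mean, exp2Mean, Finset.mul_sum]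
  exact Finset.sum_congr rfl fun v _ => mul_left_comm _ _ _

theorem exp2Mean_sum {ι : Type*} (I : Finset ι) (η : ℝ) (L : ℕ → Fin d → ℝ) (t : ℕ)
    (f : ι → Vertex d → ℝ) :
    exp2Mean S η L t (fun v => ∑ i ∈ I, f i v) = ∑ i ∈ I, exp2Mean S η L t (f i) := by
  simp only [exp2Mean, Finset.mul_sum]
  exact Finset.sum_comm

/-- The coordinate `i` of the vertex `v`, as a real number. -/
def coord (i : Fin d) (v : Vertex d) : ℝ := if v i then 1 else 0

/-- The vertex obtained from `v` by flipping the coordinates in `C`. -/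
def flip (C : Finset (Fin d)) (v : Vertex d) : Vertex d := fun i => if i ∈ C then !v i else v i

theorem flip_flip (C : Finset (Fin d)) (v : Vertex d) : flip C (flip C v) = v := by
  funext i
  by_cases h : i ∈ C <;> simp [flip, h]

/-- If flipping the coordinates in `C ∋ i` preserves `S` and switching `i` on in this way changes
the cumulative loss by `D`, then exp2 plays an action containing `i` with probability
`1 / (1 + exp (η D))`. -/
theorem exp2Mean_coord (hS : S.Nonempty) (η : ℝ) (L : ℕ → Fin d → ℝ) (t : ℕ) {i : Fin d}
    {C : Finset (Fin d)} (hi : i ∈ C) (hC : ∀ v ∈ S, flip C v ∈ S) {D : ℝ}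
    (hD : ∀ v ∈ S, v i = false →
      ∑ s ∈ Finset.range t, (lossOf (L s) (flip C v) - lossOf (L s) v) = D) :
    exp2Mean S η L t (coord i) = 1 / (1 + Real.exp (η * D)) := by
  refine marginal_eq_of_flip hS (cumulativeWeight_pos η L t) (flip C) (flip_flip C) hC
    (fun v => by simp [flip, hi]) fun v hv hvi => ?_
  rw [cumulativeWeight, cumulativeWeight, ← Real.exp_add, ← hD v hv hvi, Finset.sum_sub_distrib]
  ring_nf

/-! ### The action set -/

/-- The actions for which the coordinates `0, …, k - 1` agree with the coordinate `i₀` (which will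
be `0`), the coordinates `k, …, 2 k - 1` are opposite to it, and the others are arbitrary. -/
def coupledBlocks (k : ℕ) (i₀ : Fin d) : Finset (Vertex d) :=
  {v | ∀ i : Fin d, (i.val < k → v i = v i₀) ∧ (k ≤ i.val → i.val < 2 * k → v i = !v i₀)}

/-- A set of coordinates that parametrizes `coupledBlocks k i₀` by a full hypercube. -/
def freeCoords (k : ℕ) (i₀ : Fin d) : Finset (Fin d) := {i | i = i₀ ∨ 2 * k ≤ i.val}

/-- The coordinates that have to be flipped together with the free coordinate `i`. -/
def coordGroup (k : ℕ) (i₀ i : Fin d) : Finset (Fin d) :=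
  if i = i₀ then Finset.univ.filter fun j => j.val < 2 * k else {i}

/-- The action which contains the second block only. -/
def secondBlock (k : ℕ) : Vertex d := fun i => decide (k ≤ i.val ∧ i.val < 2 * k)

section Blocks
variable {k : ℕ} {i₀ : Fin d}

theorem mem_coupledBlocks {v : Vertex d} : v ∈ coupledBlocks k i₀ ↔ ∀ i : Fin d,
    (i.val < k → v i = v i₀) ∧ (k ≤ i.val → i.val < 2 * k → v i = !v i₀) := by
  simp [coupledBlocks]

theorem secondBlock_mem (h₀ : i₀.val < k) : (secondBlock k : Vertex d) ∈ coupledBlocks k i₀ := by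
  rw [mem_coupledBlocks]
  intro i
  have : ¬ k ≤ i₀.val := by omega
  refine ⟨fun h => ?_, fun h h' => ?_⟩
  · have : ¬ k ≤ i.val := by omega
    simp [secondBlock, *]
  · simp [secondBlock, *]

theorem mem_coordGroup (h₀ : i₀.val < k) (i : Fin d) : i ∈ coordGroup k i₀ i := by
  unfold coordGroup
  split_ifs with h
  · subst h
    simp
    omega
  · simp

theorem flip_mem_coupledBlocks (h₀ : i₀.val < k) {i : Fin d} (hi : i ∈ freeCoords k i₀)
    {v : Vertex d} (hv : v ∈ coupledBlocks k i₀) :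
    flip (coordGroup k i₀ i) v ∈ coupledBlocks k i₀ := by
  rw [mem_coupledBlocks] at hv ⊢
  intro j
  have h₀' : i₀.val < 2 * k := by omega
  by_cases hii : i = i₀
  · refine ⟨fun h => ?_, fun h h' => ?_⟩
    · have h' : j.val < 2 * k := by omega
      simp [flip, coordGroup, hii, h₀', h', (hv j).1 h]
    · simp [flip, coordGroup, hii, h₀', h', (hv j).2 h h']
  · have hi2 : 2 * k ≤ i.val := by simpa [freeCoords, hii] using hi
    refine ⟨fun h => ?_, fun h h' => ?_⟩
    · have hji : j ≠ i := by rintro rfl; omega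
      simp [flip, coordGroup, hii, hji, Ne.symm hii, (hv j).1 h]
    · have hji : j ≠ i := by rintro rfl; omega
      simp [flip, coordGroup, hii, hji, Ne.symm hii, (hv j).2 h h']

theorem flip_coordGroup_of_ne {i j : Fin d}
    (hj : j ∈ freeCoords k i₀) (hij : j ≠ i) (v : Vertex d) : flip (coordGroup k i₀ i) v j = v j := by
  have : j ∉ coordGroup k i₀ i := by
    unfold coordGroup
    split_ifs with h
    · have : 2 * k ≤ j.val := by
        simpa [freeCoords, h ▸ hij] using hj
      simpa using this
    · simpa using hij
  simp [flip, this]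

theorem card_freeCoords (h₀ : i₀.val < k) (hk : 2 * k ≤ d) :
    (freeCoords k i₀).card + 2 * k = d + 1 := by
  have h1 : freeCoords k i₀ = insert i₀ ({i | 2 * k ≤ i.val} : Finset (Fin d)) := by
    ext i
    simp [freeCoords]
  have h2 := Finset.card_filter_add_card_filter_not (s := (Finset.univ : Finset (Fin d)))
    (fun i => i.val < 2 * k)
  simp only [not_lt, Fin.card_filter_val_lt, Finset.card_univ, Fintype.card_fin] at h2
  rw [h1, Finset.card_insert_of_notMem (by simp; omega)]
  omega

/-! ### Alternating losses on the two blocks -/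

/-- Loss `1` on the first block in even rounds and on the second block in odd rounds. -/
def alternatingLoss (k t : ℕ) (i : Fin d) : ℝ :=
  if Even t then (if i.val < k then 1 else 0) else (if k ≤ i.val ∧ i.val < 2 * k then 1 else 0)

theorem lossOf_alternatingLoss (hk : 2 * k ≤ d) {v : Vertex d} (hv : v ∈ coupledBlocks k i₀)
    (t : ℕ) : lossOf (alternatingLoss k t) v =
      if Even t then k * coord i₀ v else k - k * coord i₀ v := by
  rw [mem_coupledBlocks] at hv
  have c1 : ∑ i : Fin d, (if i.val < k then (1 : ℝ) else 0) = k := by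
    rw [Finset.sum_boole, Fin.card_filter_val_lt, min_eq_right (by omega)]
  have c2 : ∑ i : Fin d, (if k ≤ i.val ∧ i.val < 2 * k then (1 : ℝ) else 0) = k := by
    have h2 : ∑ i : Fin d, (if i.val < 2 * k then (1 : ℝ) else 0) = 2 * k := by
      rw [Finset.sum_boole, Fin.card_filter_val_lt, min_eq_right hk]
      push_cast
      ring
    have h3 : ∑ i : Fin d, (if k ≤ i.val ∧ i.val < 2 * k then (1 : ℝ) else 0) =
        ∑ i : Fin d, (if i.val < 2 * k then (1 : ℝ) else 0) -
          ∑ i : Fin d, (if i.val < k then (1 : ℝ) else 0) := by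
      rw [← Finset.sum_sub_distrib]
      refine Finset.sum_congr rfl fun i _ => ?_
      split_ifs <;> first | omega | norm_num
    rw [h3, h2, c1]
    ring
  split_ifs with ht
  · rw [← c1, Finset.sum_mul]
    refine Finset.sum_congr rfl fun i _ => ?_
    by_cases h : i.val < k
    · simp [alternatingLoss, ht, h, coord, (hv i).1 h]
    · simp [alternatingLoss, ht, h]
  · have : (k : ℝ) - k * coord i₀ v = k * (1 - coord i₀ v) := by ring
    rw [this, ← c2, Finset.sum_mul]
    refine Finset.sum_congr rfl fun i _ => ?_
    by_cases h : k ≤ i.val ∧ i.val < 2 * k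
    · cases hb : v i₀ <;> simp [alternatingLoss, ht, h, coord, (hv i).2 h.1 h.2, hb]
    · simp [alternatingLoss, ht, h]

/-- Before even rounds exp2 has forgotten everything; before odd rounds it has been misled. -/
theorem exp2Mean_coord_alternatingLoss (h₀ : i₀.val < k) (hk : 2 * k ≤ d) (η : ℝ) (t : ℕ) :
    exp2Mean (coupledBlocks k i₀) η (alternatingLoss k) t (coord i₀) =
      if Even t then 1 / 2 else 1 / (1 + Real.exp (η * k)) := by
  have hmem : i₀ ∈ freeCoords k i₀ := by simp [freeCoords]
  rw [exp2Mean_coord ⟨_, secondBlock_mem h₀⟩ η (alternatingLoss k) t (mem_coordGroup h₀ i₀)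
    (fun v hv => flip_mem_coupledBlocks h₀ hmem hv) (D := if Even t then 0 else (k : ℝ))]
  · split_ifs
    · norm_num
    · rfl
  · intro v hv hvi
    have hterm : ∀ s, lossOf (alternatingLoss k s) (flip (coordGroup k i₀ i₀) v) -
        lossOf (alternatingLoss k s) v = if Even s then (k : ℝ) else -k := by
      intro s
      rw [lossOf_alternatingLoss hk (flip_mem_coupledBlocks h₀ hmem hv),
        lossOf_alternatingLoss hk hv]
      split_ifs <;> simp [coord, flip, mem_coordGroup h₀ i₀, hvi]
    simp only [hterm]
    induction t with
    | zero => simp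
    | succ t ih =>
      rw [Finset.sum_range_succ, ih]
      by_cases ht : Even t <;> simp [ht, Nat.even_add_one]

/-- Against the alternating losses, exp2 pays in each pair of rounds
`k (1 / 2 - 1 / (1 + exp (η k)))` more than the action `secondBlock k`. -/
theorem alternating_le_supRegret_exp2 (h₀ : i₀.val < k) (hk : 2 * k ≤ d) (η : ℝ) (n : ℕ) :
    ((n / 2 * (k * (1 / 2 - 1 / (1 + Real.exp (η * k)))) : ℝ) : EReal) ≤
      supRegret (exp2 (coupledBlocks k i₀) ⟨_, secondBlock_mem h₀⟩ η) n := by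
  have hS : (coupledBlocks k i₀).Nonempty := ⟨_, secondBlock_mem h₀⟩
  refine le_trans (EReal.coe_le_coe_iff.2 ?_) (sum_le_supRegret_exp2 hS η n (alternatingLoss k)
    (fun t i => by unfold alternatingLoss; split_ifs <;> norm_num)
    (fun t i => by unfold alternatingLoss; split_ifs <;> norm_num) (secondBlock_mem h₀))
  set p := 1 / (1 + Real.exp (η * k))
  have hp : 0 ≤ p := by positivity
  have hterm : ∀ t, exp2Mean (coupledBlocks k i₀) η (alternatingLoss k) t
      (lossOf (alternatingLoss k t)) - lossOf (alternatingLoss k t) (secondBlock k : Vertex d) =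
      if Even t then (k : ℝ) / 2 else -k * p := by
    intro t
    have hsb : coord i₀ (secondBlock k : Vertex d) = 0 := by
      simp [coord, secondBlock, h₀]
    have hmean := exp2Mean_coord_alternatingLoss h₀ hk η t
    rw [exp2Mean_congr (fun v hv => lossOf_alternatingLoss hk hv t),
      lossOf_alternatingLoss hk (secondBlock_mem h₀), hsb]
    by_cases ht : Even t
    · simp only [ht, if_true] at hmean ⊢
      rw [exp2Mean_const_mul, hmean]
      ring
    · simp only [ht, if_false] at hmean ⊢
      have hlin : exp2Mean (coupledBlocks k i₀) η (alternatingLoss k) t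
          (fun v => k - k * coord i₀ v) = k - k * p := by
        rw [exp2Mean_sub, exp2Mean_const hS, exp2Mean_const_mul, hmean]
      rw [hlin]
      ring
  have hsum : ∑ t ∈ Finset.range n, (if Even t then (k : ℝ) / 2 else -k * p) =
      n / 2 * (k * (1 / 2 - p)) + if Even n then 0 else k / 4 + k * p / 2 := by
    induction n with
    | zero => simp
    | succ n ih =>
      rw [Finset.sum_range_succ, ih]
      by_cases hn : Even n <;> simp only [hn, Nat.even_add_one, if_true, if_false, not_true,
        not_false_iff] <;> push_cast <;> ring
  simp only [hterm]
  rw [hsum]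
  have : (0 : ℝ) ≤ if Even n then 0 else k / 4 + k * p / 2 := by
    split_ifs <;> positivity
  linarith

/-! ### Constant losses on the free coordinates -/

/-- Loss `ε` on every free coordinate. -/
def freeLoss (k : ℕ) (i₀ : Fin d) (ε : ℝ) (i : Fin d) : ℝ := if i ∈ freeCoords k i₀ then ε else 0

theorem lossOf_freeLoss (ε : ℝ) (v : Vertex d) :
    lossOf (freeLoss k i₀ ε) v = ε * ∑ i ∈ freeCoords k i₀, coord i v := by
  rw [Finset.mul_sum, lossOf, ← Finset.sum_filter_add_sum_filter_not Finset.univ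
    (fun i => i ∈ freeCoords k i₀)]
  simp only [Finset.filter_univ_mem]
  rw [Finset.sum_eq_zero (s := Finset.univ.filter fun i => i ∉ freeCoords k i₀), add_zero]
  · refine Finset.sum_congr rfl fun i hi => ?_
    simp [freeLoss, hi, coord]
  · intro i hi
    simp [freeLoss, (Finset.mem_filter.1 hi).2]

/-- On each free coordinate exp2 behaves as with two experts. -/
theorem exp2Mean_coord_freeLoss (h₀ : i₀.val < k) (η ε : ℝ) (t : ℕ) {i : Fin d}
    (hi : i ∈ freeCoords k i₀) :
    exp2Mean (coupledBlocks k i₀) η (fun _ => freeLoss k i₀ ε) t (coord i) =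
      1 / (1 + Real.exp (η * (t * ε))) := by
  refine exp2Mean_coord ⟨_, secondBlock_mem h₀⟩ η _ t (mem_coordGroup h₀ i)
    (fun v hv => flip_mem_coupledBlocks h₀ hi hv) fun v _ hvi => ?_
  rw [Finset.sum_const, Finset.card_range, nsmul_eq_mul]
  congr 1
  rw [lossOf_freeLoss, lossOf_freeLoss, ← mul_sub, ← Finset.sum_sub_distrib,
    Finset.sum_eq_single_of_mem i hi]
  · simp [coord, flip, mem_coordGroup h₀ i, hvi]
  · intro j hj hji
    simp [coord, flip_coordGroup_of_ne hj hji]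

/-- As long as `η` times the cumulative loss of a free coordinate is at most `1`, exp2 keeps this
coordinate with probability at least `1 / (1 + e) ≥ 1 / 4`, whereas `secondBlock k` never pays. -/
theorem constant_le_supRegret_exp2 (h₀ : i₀.val < k) {η ε : ℝ} (hε : 0 ≤ ε) (hε1 : ε ≤ 1) {n : ℕ}
    (hη : η * (n * ε) ≤ 1) :
    ((n * (ε * ((freeCoords k i₀).card * (1 / 4))) : ℝ) : EReal) ≤
      supRegret (exp2 (coupledBlocks k i₀) ⟨_, secondBlock_mem h₀⟩ η) n := by
  have hS : (coupledBlocks k i₀).Nonempty := ⟨_, secondBlock_mem h₀⟩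
  refine le_trans (EReal.coe_le_coe_iff.2 ?_) (sum_le_supRegret_exp2 hS η n
    (fun _ => freeLoss k i₀ ε) (fun t i => by unfold freeLoss; split_ifs <;> simp [hε])
    (fun t i => by unfold freeLoss; split_ifs <;> simp [hε1]) (secondBlock_mem h₀))
  have hsb : lossOf (freeLoss k i₀ ε) (secondBlock k : Vertex d) = 0 := by
    rw [lossOf_freeLoss, Finset.sum_eq_zero, mul_zero]
    intro i hi
    have : ¬ (k ≤ i.val ∧ i.val < 2 * k) := by
      rcases (Finset.mem_filter.1 hi).2 with rfl | h <;> omega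
    simp [coord, secondBlock, this]
  calc (n * (ε * ((freeCoords k i₀).card * (1 / 4))) : ℝ)
      = ∑ _t ∈ Finset.range n, ε * ∑ _i ∈ freeCoords k i₀, (1 / 4 : ℝ) := by simp
    _ ≤ _ := by
      refine Finset.sum_le_sum fun t ht => ?_
      rw [hsb, sub_zero, exp2Mean_congr (fun v _ => lossOf_freeLoss ε v), exp2Mean_const_mul,
        exp2Mean_sum]
      refine mul_le_mul_of_nonneg_left (Finset.sum_le_sum fun i hi => ?_) hε
      rw [exp2Mean_coord_freeLoss h₀ η ε t hi]
      have hle : η * (t * ε) ≤ 1 := by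
        rcases le_total η 0 with h | h
        · have : η * (t * ε) ≤ 0 := mul_nonpos_of_nonpos_of_nonneg h (by positivity)
          linarith
        · refine le_trans ?_ hη
          have : (t : ℝ) ≤ n := by exact_mod_cast (Finset.mem_range.1 ht).le
          gcongr
      have he : Real.exp (η * (t * ε)) ≤ 3 :=
        (Real.exp_le_exp.2 hle).trans (by linarith [Real.exp_one_lt_d9])
      refine one_div_le_one_div_of_le (by positivity) (by linarith)

end Blocks

/-! ### Projected gradient descent -/

section Projection
variable {E : Type*} [NormedAddCommGroup E] [InnerProductSpace ℝ E]

/-- A complete convex set has a nearest-point map. It is returned with its variational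
characterization and the nonexpansiveness which that implies. -/
theorem exists_convexProjection {K : Set E} (ne : K.Nonempty) (hK : IsComplete K)
    (hc : Convex ℝ K) :
    ∃ P : E → E, (∀ x, P x ∈ K) ∧ (∀ x, ∀ w ∈ K, inner ℝ (x - P x) (w - P x) ≤ 0) ∧
      Continuous P := by
  have h := fun u => exists_norm_eq_iInf_of_complete_convex ne hK hc u
  choose P hP hmin using h
  have hvar : ∀ x, ∀ w ∈ K, inner ℝ (x - P x) (w - P x) ≤ 0 := fun x =>
    (norm_eq_iInf_iff_real_inner_le_zero hc (hP x)).1 (hmin x)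
  refine ⟨P, hP, hvar, (LipschitzWith.of_dist_le_mul (K := 1) fun x y => ?_).continuous⟩
  rw [NNReal.coe_one, one_mul, dist_eq_norm, dist_eq_norm]
  have h1 := hvar x (P y) (hP y)
  have h2 := hvar y (P x) (hP x)
  have h3 : inner ℝ (P x - P y) (P x - P y) ≤ inner ℝ (x - y) (P x - P y) := by
    have e1 : inner ℝ (x - P x) (P y - P x) = -inner ℝ (x - P x) (P x - P y) := by
      rw [← inner_neg_right, neg_sub]
    have e2 : inner ℝ (x - y) (P x - P y) = inner ℝ (x - P x) (P x - P y) +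
        inner ℝ (P x - P y) (P x - P y) - inner ℝ (y - P y) (P x - P y) := by
      rw [← inner_add_left, ← inner_sub_left]
      congr 1
      abel
    linarith
  rw [real_inner_self_eq_norm_sq] at h3
  have h4 := h3.trans (real_inner_le_norm _ _)
  by_contra! hlt
  have : 0 < ‖P x - P y‖ := (norm_nonneg _).trans_lt hlt
  nlinarith

/-- One step of projected gradient descent: the instantaneous regret against `w` is paid for by the
decrease of the squared distance to `w`. -/
theorem inner_le_of_projected_step {x y w ℓ : E} {η : ℝ} (hη : 0 < η)
    (hy : inner ℝ (x - η • ℓ - y) (w - y) ≤ 0) :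
    inner ℝ ℓ (x - w) + ‖y - w‖ ^ 2 / (2 * η) ≤ ‖x - w‖ ^ 2 / (2 * η) + η * ‖ℓ‖ ^ 2 / 2 := by
  have e1 : ‖x - η • ℓ - w‖ ^ 2 = ‖x - w‖ ^ 2 - 2 * η * inner ℝ ℓ (x - w) + η ^ 2 * ‖ℓ‖ ^ 2 := by
    rw [sub_right_comm, norm_sub_sq_real, inner_smul_right, norm_smul, real_inner_comm, mul_pow,
      Real.norm_eq_abs, sq_abs]
    ring
  have e2 : ‖x - η • ℓ - w‖ ^ 2 = ‖x - η • ℓ - y‖ ^ 2 -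
      2 * inner ℝ (x - η • ℓ - y) (w - y) + ‖w - y‖ ^ 2 := by
    rw [← norm_sub_sq_real, sub_sub_sub_cancel_right]
  rw [norm_sub_rev w y] at e2
  have h : 2 * η * inner ℝ ℓ (x - w) + ‖y - w‖ ^ 2 ≤ ‖x - w‖ ^ 2 + η ^ 2 * ‖ℓ‖ ^ 2 := by
    nlinarith [sq_nonneg ‖x - η • ℓ - y‖]
  have h' : inner ℝ ℓ (x - w) + ‖y - w‖ ^ 2 / (2 * η) =
      (2 * η * inner ℝ ℓ (x - w) + ‖y - w‖ ^ 2) / (2 * η) := by field_simp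
  have h'' : ‖x - w‖ ^ 2 / (2 * η) + η * ‖ℓ‖ ^ 2 / 2 =
      (‖x - w‖ ^ 2 + η ^ 2 * ‖ℓ‖ ^ 2) / (2 * η) := by field_simp
  rw [h', h'']
  gcongr

end Projection

/-! ### Means lifted to distributions -/

/-- The space of pairs formed by a mean action in `ℝ^d` and a family of weights on the vertices. -/
abbrev LiftSpace (d : ℕ) : Type := EuclideanSpace ℝ (Fin d ⊕ Vertex d)

/-- The pairs formed by a probability distribution on `S` and its mean. Keeping the distribution
beside its mean makes the distribution a continuous function of the point. -/
def lift (S : Finset (Vertex d)) : Set (LiftSpace d) :=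
  {x | (∀ v, 0 ≤ x (Sum.inr v)) ∧ ∑ v ∈ S, x (Sum.inr v) = 1 ∧
    ∀ i, x (Sum.inl i) = ∑ v ∈ S, x (Sum.inr v) * if v i then 1 else 0}

/-- The Dirac mass at `v` with its mean. -/
noncomputable def liftVertex (v : Vertex d) : LiftSpace d :=
  WithLp.toLp 2 (Sum.elim (fun i => if v i then 1 else 0) (Pi.single v 1))

/-- A loss vector, acting on the mean only. -/
noncomputable def liftLoss (ℓ : Fin d → ℝ) : LiftSpace d :=
  WithLp.toLp 2 (Sum.elim ℓ 0)

theorem liftVertex_mem {v : Vertex d} (hv : v ∈ S) : liftVertex v ∈ lift S := by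
  refine ⟨fun u => ?_, ?_, fun i => ?_⟩
  · simp only [liftVertex, Sum.elim_inr, Pi.single_apply]
    split_ifs <;> norm_num
  · simp [liftVertex, Pi.single_apply, hv]
  · simp only [liftVertex, Sum.elim_inl, Sum.elim_inr, Pi.single_apply, ite_mul, one_mul, zero_mul,
      Finset.sum_ite_eq', hv, if_true]

theorem isClosed_lift (S : Finset (Vertex d)) : IsClosed (lift S) := by
  have h : lift S = (⋂ v, {x | 0 ≤ x (Sum.inr v)}) ∩ {x | ∑ v ∈ S, x (Sum.inr v) = 1} ∩
      ⋂ i, {x | x (Sum.inl i) = ∑ v ∈ S, x (Sum.inr v) * if v i then 1 else 0} := by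
    ext x
    simp [lift, and_assoc]
  rw [h]
  refine ((isClosed_iInter fun v => isClosed_le (by fun_prop) (by fun_prop)).inter
    (isClosed_eq (by fun_prop) (by fun_prop))).inter
    (isClosed_iInter fun i => isClosed_eq (by fun_prop) (by fun_prop))

theorem convex_lift (S : Finset (Vertex d)) : Convex ℝ (lift S) := by
  rintro x ⟨hx0, hx1, hx2⟩ y ⟨hy0, hy1, hy2⟩ a b ha hb hab
  refine ⟨fun v => ?_, ?_, fun i => ?_⟩
  · have := hx0 v
    have := hy0 v
    simp only [PiLp.add_apply, PiLp.smul_apply, smul_eq_mul]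
    positivity
  · simp only [PiLp.add_apply, PiLp.smul_apply, smul_eq_mul, Finset.sum_add_distrib,
      ← Finset.mul_sum, hx1, hy1, mul_one, hab]
  · simp only [PiLp.add_apply, PiLp.smul_apply, smul_eq_mul, hx2, hy2, add_mul,
      Finset.sum_add_distrib, Finset.mul_sum, mul_assoc]

theorem inner_liftLoss (ℓ : Fin d → ℝ) (x : LiftSpace d) :
    inner ℝ (liftLoss ℓ) x = ∑ i, ℓ i * x (Sum.inl i) := by
  simp [liftLoss, PiLp.inner_apply, Fintype.sum_sum_type, mul_comm]

theorem inner_liftLoss_of_mem {x : LiftSpace d} (hx : x ∈ lift S) (ℓ : Fin d → ℝ) :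
    inner ℝ (liftLoss ℓ) x = ∑ v ∈ S, x (Sum.inr v) * lossOf ℓ v := by
  rw [inner_liftLoss]
  simp only [hx.2.2, lossOf, Finset.mul_sum]
  rw [Finset.sum_comm]
  refine Finset.sum_congr rfl fun v _ => Finset.sum_congr rfl fun i _ => ?_
  split_ifs <;> ring

theorem inner_liftLoss_liftVertex (ℓ : Fin d → ℝ) (u : Vertex d) :
    inner ℝ (liftLoss ℓ) (liftVertex u) = lossOf ℓ u := by
  rw [inner_liftLoss]
  simp [liftVertex, lossOf]

theorem norm_liftLoss_sq_le {ℓ : Fin d → ℝ} (h0 : ∀ i, 0 ≤ ℓ i) (h1 : ∀ i, ℓ i ≤ 1) :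
    ‖liftLoss ℓ‖ ^ 2 ≤ d := by
  rw [← real_inner_self_eq_norm_sq, inner_liftLoss]
  calc ∑ i, ℓ i * liftLoss ℓ (Sum.inl i) ≤ ∑ _i : Fin d, (1 : ℝ) :=
        Finset.sum_le_sum fun i _ => by
          simp only [liftLoss, Sum.elim_inl]
          nlinarith [h0 i, h1 i]
    _ = d := by simp

theorem norm_liftVertex_sub_sq_le (u v : Vertex d) : ‖liftVertex u - liftVertex v‖ ^ 2 ≤ d + 2 := by
  rw [EuclideanSpace.norm_sq_eq, Fintype.sum_sum_type]
  simp only [PiLp.sub_apply, liftVertex, Sum.elim_inl, Sum.elim_inr, Real.norm_eq_abs, sq_abs]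
  have h1 : ∑ i, ((if u i then (1 : ℝ) else 0) - if v i then 1 else 0) ^ 2 ≤ (d : ℝ) := by
    calc ∑ i, ((if u i then (1 : ℝ) else 0) - if v i then 1 else 0) ^ 2
        ≤ ∑ _i : Fin d, (1 : ℝ) := Finset.sum_le_sum fun i _ => by split_ifs <;> norm_num
      _ = d := by simp
  have h2 : ∑ w, ((Pi.single u 1 : Vertex d → ℝ) w - (Pi.single v 1 : Vertex d → ℝ) w) ^ 2 ≤ 2 := by
    calc _ ≤ ∑ w, ((Pi.single u 1 : Vertex d → ℝ) w + (Pi.single v 1 : Vertex d → ℝ) w) :=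
          Finset.sum_le_sum fun w _ => by
            simp only [Pi.single_apply]
            split_ifs <;> norm_num
      _ = 2 := by
        rw [Finset.sum_add_distrib]
        simp
        norm_num
  linarith

theorem continuous_liftLoss : Continuous (liftLoss : (Fin d → ℝ) → LiftSpace d) := by
  refine (PiLp.continuous_toLp 2 _).comp (continuous_pi fun j => ?_)
  cases j with
  | inl i => exact continuous_apply i
  | inr v => exact continuous_const

/-! ### The descent forecaster -/

/-- The iterates of projected gradient descent with projection `P`, step size `η` and initial
point `x₀`. -/
noncomputable def descentPoint (P : LiftSpace d → LiftSpace d) (η : ℝ) (x₀ : LiftSpace d) :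
    (t : ℕ) → (Fin t → Fin d → ℝ) → LiftSpace d
  | 0, _ => x₀
  | t + 1, ℓ => P (descentPoint P η x₀ t (fun s => ℓ s.castSucc) - η • liftLoss (ℓ (Fin.last t)))

theorem descentPoint_snoc (P : LiftSpace d → LiftSpace d) (η : ℝ) (x₀ : LiftSpace d) (t : ℕ)
    (ℓ : Fin t → Fin d → ℝ) (a : Fin d → ℝ) :
    descentPoint P η x₀ (t + 1) (Fin.snoc (α := fun _ => Fin d → ℝ) ℓ a) =
      P (descentPoint P η x₀ t ℓ - η • liftLoss a) := by
  simp [descentPoint]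

theorem descentPoint_mem {P : LiftSpace d → LiftSpace d} (hP : ∀ x, P x ∈ lift S) (η : ℝ)
    {x₀ : LiftSpace d} (hx₀ : x₀ ∈ lift S) (t : ℕ) (ℓ : Fin t → Fin d → ℝ) :
    descentPoint P η x₀ t ℓ ∈ lift S := by
  cases t with
  | zero => exact hx₀
  | succ t => exact hP _

theorem continuous_descentPoint {P : LiftSpace d → LiftSpace d} (hP : Continuous P) (η : ℝ)
    (x₀ : LiftSpace d) (t : ℕ) : Continuous (descentPoint P η x₀ t) := by
  induction t with
  | zero => exact continuous_const
  | succ t ih =>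
    refine hP.comp ((ih.comp (by fun_prop)).sub
      ((continuous_liftLoss.comp (by fun_prop)).const_smul η))

/-- The forecaster that draws its action from the distribution carried by the current iterate of
projected gradient descent on `lift S`. -/
noncomputable def descentForecaster (P : LiftSpace d → LiftSpace d) (hP : ∀ x, P x ∈ lift S)
    (hPc : Continuous P) (η : ℝ) (x₀ : LiftSpace d) (hx₀ : x₀ ∈ lift S) : Forecaster S where
  prob t _ ℓ v := descentPoint P η x₀ t ℓ (Sum.inr v)
  prob_nonneg t _ ℓ v _ := (descentPoint_mem hP η hx₀ t ℓ).1 v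
  sum_prob t _ ℓ := (descentPoint_mem hP η hx₀ t ℓ).2.1
  measurable_prob t _ v _ :=
    ((EuclideanSpace.proj (𝕜 := ℝ) (Sum.inr v : Fin d ⊕ Vertex d)).continuous.comp
      (continuous_descentPoint hPc η x₀ t)).measurable

/-- The regret bound of projected gradient descent, from any round on and for any adaptive rule `a`
of the adversary. -/
theorem expectedSum_descentForecaster_le {P : LiftSpace d → LiftSpace d} (hP : ∀ x, P x ∈ lift S)
    (hPc : Continuous P) (hvar : ∀ x, ∀ w ∈ lift S, inner ℝ (x - P x) (w - P x) ≤ 0)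
    {η : ℝ} (hη : 0 < η) {x₀ : LiftSpace d} (hx₀ : x₀ ∈ lift S)
    (a : (t : ℕ) → (Fin t → Vertex d) → Fin d → ℝ) (h0 : ∀ t V i, 0 ≤ a t V i)
    (h1 : ∀ t V i, a t V i ≤ 1) {u : Vertex d} (hu : u ∈ S) (k t : ℕ) (V : Fin t → Vertex d)
    (ℓ : Fin t → Fin d → ℝ) :
    (descentForecaster P hP hPc η x₀ hx₀).expectedSum a
        (fun v ℓ => lossOf ℓ v - lossOf ℓ u) k t V ℓ ≤
      ‖descentPoint P η x₀ t ℓ - liftVertex u‖ ^ 2 / (2 * η) + k * (η * d / 2) := by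
  induction k generalizing t with
  | zero =>
    simp only [Forecaster.expectedSum]
    positivity
  | succ k ih =>
    set F := descentForecaster P hP hPc η x₀ hx₀
    set x := descentPoint P η x₀ t ℓ
    set y := P (x - η • liftLoss (a t V))
    have hx : x ∈ lift S := descentPoint_mem hP η hx₀ t ℓ
    have hstep := inner_le_of_projected_step hη
      (hvar (x - η • liftLoss (a t V)) (liftVertex u) (liftVertex_mem hu))
    rw [inner_sub_right, inner_liftLoss_of_mem hx, inner_liftLoss_liftVertex] at hstep
    have hnorm := norm_liftLoss_sq_le (h0 t V) (h1 t V)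
    calc F.expectedSum a (fun v ℓ => lossOf ℓ v - lossOf ℓ u) (k + 1) t V ℓ
        ≤ ∑ v ∈ S, x (Sum.inr v) * (lossOf (a t V) v - lossOf (a t V) u +
            (‖y - liftVertex u‖ ^ 2 / (2 * η) + k * (η * d / 2))) := by
          refine Finset.sum_le_sum fun v _ => mul_le_mul_of_nonneg_left ?_ (hx.1 v)
          refine add_le_add_right ((ih (t + 1) _ _).trans_eq ?_) _
          rw [descentPoint_snoc]
      _ = ∑ v ∈ S, x (Sum.inr v) * lossOf (a t V) v - lossOf (a t V) u +
            (‖y - liftVertex u‖ ^ 2 / (2 * η) + k * (η * d / 2)) := by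
          simp only [mul_add, mul_sub, Finset.sum_add_distrib, Finset.sum_sub_distrib,
            ← Finset.sum_mul, hx.2.1, one_mul]
      _ ≤ ‖x - liftVertex u‖ ^ 2 / (2 * η) + η * ‖liftLoss (a t V)‖ ^ 2 / 2 +
            k * (η * d / 2) := by linarith
      _ ≤ ‖x - liftVertex u‖ ^ 2 / (2 * η) + η * d / 2 + k * (η * d / 2) := by gcongr
      _ = _ := by
          push_cast
          ring

/-! ### From conditional regret to regret -/

theorem lossOf_nonneg {ℓ : Fin d → ℝ} (h0 : ∀ i, 0 ≤ ℓ i) (v : Vertex d) : 0 ≤ lossOf ℓ v :=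
  Finset.sum_nonneg fun i _ => by split_ifs <;> simp [h0]

theorem lossOf_le {ℓ : Fin d → ℝ} (h1 : ∀ i, ℓ i ≤ 1) (v : Vertex d) : lossOf ℓ v ≤ d := by
  calc lossOf ℓ v ≤ ∑ _i : Fin d, (1 : ℝ) :=
        Finset.sum_le_sum fun i _ => by split_ifs <;> simp [h1]
    _ = d := by simp

theorem expectedSum_sub (F : Forecaster S) (a : (t : ℕ) → (Fin t → Vertex d) → Fin d → ℝ)
    (g h : Vertex d → (Fin d → ℝ) → ℝ) (k t : ℕ) (V : Fin t → Vertex d) (ℓ : Fin t → Fin d → ℝ) :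
    F.expectedSum a (fun v ℓ => g v ℓ - h v ℓ) k t V ℓ =
      F.expectedSum a g k t V ℓ - F.expectedSum a h k t V ℓ := by
  induction k generalizing t with
  | zero => simp [Forecaster.expectedSum]
  | succ k ih =>
    simp only [Forecaster.expectedSum, ih, ← Finset.sum_sub_distrib]
    refine Finset.sum_congr rfl fun v _ => ?_
    ring

theorem abs_expectedSum_le (F : Forecaster S) (a : (t : ℕ) → (Fin t → Vertex d) → Fin d → ℝ)
    {g : Vertex d → (Fin d → ℝ) → ℝ} {C : ℝ} (hg : ∀ v t V, |g v (a t V)| ≤ C) (k t : ℕ)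
    (V : Fin t → Vertex d) (ℓ : Fin t → Fin d → ℝ) :
    |F.expectedSum a g k t V ℓ| ≤ k * C := by
  induction k generalizing t with
  | zero => simp [Forecaster.expectedSum]
  | succ k ih =>
    simp only [Forecaster.expectedSum]
    calc _ ≤ ∑ v ∈ S, F.prob t V ℓ v * (C + k * C) := by
          refine (Finset.abs_sum_le_sum_abs _ _).trans (Finset.sum_le_sum fun v hv => ?_)
          rw [abs_mul, abs_of_nonneg (F.prob_nonneg t V ℓ v hv)]
          exact mul_le_mul_of_nonneg_left ((abs_add_le _ _).trans (add_le_add (hg _ _ _) (ih _ _ _)))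
            (F.prob_nonneg t V ℓ v hv)
      _ = (k + 1 : ℕ) * C := by
          rw [← Finset.sum_mul, F.sum_prob]
          push_cast
          ring

theorem measurable_expectedSum (F : Forecaster S) (A : Adversary d)
    {g : Vertex d → (Fin d → ℝ) → ℝ} (hg : ∀ v, Measurable (g v)) (k t : ℕ)
    (V : Fin t → Vertex d) {ℓ : A.Ω → Fin t → Fin d → ℝ} (hℓ : Measurable ℓ) :
    Measurable fun ω => F.expectedSum (A.loss ω) g k t V (ℓ ω) := by
  induction k generalizing t with
  | zero => simp only [Forecaster.expectedSum, measurable_const]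
  | succ k ih =>
    simp only [Forecaster.expectedSum]
    refine Finset.measurable_sum _ fun v hv => ((F.measurable_prob t V v hv).comp hℓ).mul
      (((hg v).comp (A.measurable_loss t V)).add (ih _ _ (measurable_pi_lambda _ fun s => ?_)))
    refine Fin.lastCases ?_ (fun s => ?_) s
    · simpa only [Fin.snoc_last] using A.measurable_loss t V
    · simp only [Fin.snoc_castSucc]
      exact (measurable_pi_apply s).comp hℓ

theorem integrable_expectedSum (F : Forecaster S) (A : Adversary d)
    {g : Vertex d → (Fin d → ℝ) → ℝ} (hg : ∀ v, Measurable (g v)) {C : ℝ}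
    (hC : ∀ ω v t V, |g v (A.loss ω t V)| ≤ C) (n : ℕ) :
    MeasureTheory.Integrable
      (fun ω => F.expectedSum (A.loss ω) g n 0 Fin.elim0 Fin.elim0) A.μ :=
  MeasureTheory.Integrable.of_bound
    (measurable_expectedSum F A hg n 0 _ measurable_const).aestronglyMeasurable (n * C)
    (Filter.Eventually.of_forall fun ω => abs_expectedSum_le F _ (hC ω) n 0 _ _)

/-- A bound on the conditional regret that holds for every seed of every adversary bounds the
supremum of the regret. -/
theorem supRegret_le (F : Forecaster S) (n : ℕ) {B : ℝ}
    (hB : ∀ (A : Adversary d) (ω : A.Ω), ∀ u ∈ S, F.expectedSum (A.loss ω)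
      (fun v ℓ => lossOf ℓ v - lossOf ℓ u) n 0 Fin.elim0 Fin.elim0 ≤ B) :
    supRegret F n ≤ (B : EReal) := by
  refine iSup_le fun A => EReal.coe_le_coe_iff.2 ?_
  obtain ⟨u, hu, hmin⟩ := Finset.exists_mem_eq_inf' F.nonempty
    (fun u => expectation F A n (fun _ ℓ => lossOf ℓ u))
  have hbound : ∀ ω t V v, |lossOf (A.loss ω t V) v| ≤ d := fun ω t V v => by
    rw [abs_of_nonneg (lossOf_nonneg (A.loss_nonneg ω t V) v)]
    exact lossOf_le (A.loss_le_one ω t V) v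
  have i1 := integrable_expectedSum F A (g := fun v ℓ => lossOf ℓ v) measurable_lossOf
    (fun ω v t V => hbound ω t V v) n
  have i2 := integrable_expectedSum F A (g := fun _ ℓ => lossOf ℓ u)
    (fun _ => measurable_lossOf u) (fun ω _ t V => hbound ω t V u) n
  rw [regret, hmin, expectation, expectation, ← MeasureTheory.integral_sub i1 i2]
  calc _ ≤ ∫ _ω, B ∂A.μ := by
        refine MeasureTheory.integral_mono (i1.sub i2) (MeasureTheory.integrable_const B)
          fun ω => ?_
        have := hB A ω u hu
        rwa [expectedSum_sub] at this
    _ = B := by simp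

/-- Projected gradient descent on `lift S` shows that the minimax regret is at most `d √(2 n)` for
every action set. -/
theorem minimaxRegret_le (hd : 2 ≤ d) (hS : S.Nonempty) {n : ℕ} (hn : 0 < n) :
    minimaxRegret S n ≤ (((d : ℝ) * √(2 * (n : ℝ)) : ℝ) : EReal) := by
  obtain ⟨v₀, hv₀⟩ := hS
  obtain ⟨P, hP, hvar, hPc⟩ := exists_convexProjection ⟨_, liftVertex_mem hv₀⟩
    (isClosed_lift S).isComplete (convex_lift S)
  have hn' : (0 : ℝ) < n := by exact_mod_cast hn
  have hd' : (2 : ℝ) ≤ d := by exact_mod_cast hd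
  -- The step size balances `2 d / (2 η)` against `n η d / 2`.
  set s := √(2 * (n : ℝ)) with hs
  have hs0 : 0 < s := Real.sqrt_pos.2 (by positivity)
  have hs2 : s ^ 2 = 2 * n := Real.sq_sqrt (by positivity)
  have hη : 0 < 2 / s := by positivity
  refine (iInf_le _ (descentForecaster P hP hPc (2 / s) (liftVertex v₀)
    (liftVertex_mem hv₀))).trans (supRegret_le _ n fun A ω u hu => ?_)
  refine (expectedSum_descentForecaster_le hP hPc hvar hη (liftVertex_mem hv₀) (A.loss ω)
    (A.loss_nonneg ω) (A.loss_le_one ω) hu n 0 _ _).trans ?_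
  have hdist : ‖descentPoint P (2 / s) (liftVertex v₀) 0 Fin.elim0 - liftVertex u‖ ^ 2 ≤
      2 * (d : ℝ) := (norm_liftVertex_sub_sq_le v₀ u).trans (by linarith)
  calc _ ≤ 2 * (d : ℝ) / (2 * (2 / s)) + n * (2 / s * d / 2) := by gcongr
    _ = d * (s / 2) + d * (2 * n) / (2 * s) := by field_simp
    _ = d * s := by
      rw [← hs2]
      field_simp
      ring

end

/-! ### The balance of the two lower bounds -/

theorem cube_le_of_third (d : ℕ) (hd : 2 ≤ d) {k c : ℕ} (hk : k = (d + 1) / 3)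
    (hc : c + 2 * k = d + 1) : d ^ 3 ≤ 27 * (k ^ 2 * c) ∧ d ≤ 4 * k ∧ d ≤ 3 * c := by
  refine ⟨?_, by omega, by omega⟩
  obtain ⟨q, rfl | rfl | rfl⟩ : ∃ q, d = 3 * q ∨ d = 3 * q + 1 ∨ d = 3 * q + 2 :=
    ⟨d / 3, by omega⟩
  · obtain rfl : k = q := by omega
    obtain rfl : c = k + 1 := by omega
    nlinarith [sq_nonneg k]
  · obtain rfl : k = q := by omega
    obtain rfl : c = k + 2 := by omega
    have : 1 ≤ k := by omega
    nlinarith [Nat.mul_le_mul this this]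
  · obtain rfl : k = q + 1 := by omega
    obtain rfl : c = q + 1 := by omega
    nlinarith

/-- The elementary bound `(1 / 2) tanh (x / 2) ≥ x / (2 (2 + x))`. -/
theorem half_sub_logistic_ge {x : ℝ} (hx : 0 ≤ x) :
    x / (2 * (2 + x)) ≤ 1 / 2 - 1 / (1 + Real.exp x) := by
  have h1 : 1 / (1 + Real.exp x) ≤ 1 / (2 + x) :=
    one_div_le_one_div_of_le (by positivity) (by linarith [Real.add_one_le_exp x])
  have h2 : x / (2 * (2 + x)) = 1 / 2 - 1 / (2 + x) := by field_simp; ring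
  linarith

theorem le_or_le_of_sq_le_mul {T a b : ℝ} (hb : 0 ≤ b) (h : T ^ 2 ≤ a * b) :
    T ≤ a ∨ T ≤ b := by
  by_contra! hlt
  nlinarith [mul_le_mul_of_nonneg_right hlt.1.le hb]

end CombGame

open CombGame in
theorem mainTheorem1 (d n : ℕ) (hd : 2 ≤ d) (hn : d ≤ n) :
    ∃ (S : Finset (CombGame.Vertex d)) (hS : S.Nonempty),
      (∀ η : ℝ, ((0.02 * (d : ℝ) ^ (3 / 2 : ℝ) * √(n : ℝ) : ℝ) : EReal) ≤
        CombGame.supRegret (CombGame.exp2 S hS η) n) ∧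
      CombGame.minimaxRegret S n ≤ (((d : ℝ) * √(2 * (n : ℝ)) : ℝ) : EReal) := by
  -- Blocks of size about `d / 3` maximize `k ^ 2 * c`, where `c = d + 1 - 2 k` counts free coordinates.
  obtain ⟨k, hk⟩ : ∃ k, k = (d + 1) / 3 := ⟨_, rfl⟩
  let i₀ : Fin d := ⟨0, by omega⟩
  have h₀ : i₀.val < k := by simp only [i₀]; omega
  have hkd : 2 * k ≤ d := by omega
  refine ⟨coupledBlocks k i₀, ⟨_, secondBlock_mem h₀⟩, fun η => ?_,
    minimaxRegret_le hd ⟨_, secondBlock_mem h₀⟩ (by omega)⟩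
  obtain ⟨h3, hk4, hc3⟩ := cube_le_of_third d hd hk (card_freeCoords h₀ hkd)
  have hA := alternating_le_supRegret_exp2 h₀ hkd η n
  have hC := fun ε hε hε1 hη => constant_le_supRegret_exp2 (i₀ := i₀) h₀ (η := η) (ε := ε) (n := n)
    hε hε1 hη
  set c := (freeCoords k i₀).card
  have hn0 : (0 : ℝ) < n := by exact_mod_cast (by omega : 0 < n)
  have hk0 : (0 : ℝ) < k := by exact_mod_cast (by omega : 0 < k)
  have hd0 : (0 : ℝ) < d := by exact_mod_cast (by omega : 0 < d)
  have hdn : (d : ℝ) ≤ n := by exact_mod_cast hn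
  have h3' : (d : ℝ) ^ 3 ≤ 27 * (k ^ 2 * c) := by exact_mod_cast h3
  have hk4' : (d : ℝ) ≤ 4 * k := by exact_mod_cast hk4
  have hc3' : (d : ℝ) ≤ 3 * c := by exact_mod_cast hc3
  set T := 0.02 * (d : ℝ) ^ (3 / 2 : ℝ) * √(n : ℝ) with hT
  have hTsq : T ^ 2 = 0.0004 * d ^ 3 * n := by
    have : ((d : ℝ) ^ (3 / 2 : ℝ)) ^ 2 = d ^ 3 := by
      rw [← Real.rpow_natCast, ← Real.rpow_mul hd0.le, ← Real.rpow_natCast]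
      norm_num
    rw [hT, mul_pow, mul_pow, this, Real.sq_sqrt hn0.le]
    norm_num
  have hTlin : T ≤ 0.02 * (d * n) := by
    refine abs_le_of_sq_le_sq' ?_ (by positivity) |>.2
    rw [hTsq]
    have : (d : ℝ) ^ 2 * n * d ≤ d ^ 2 * n * n := by gcongr
    nlinarith
  by_cases hsmall : η * n ≤ 1
  · refine le_trans (EReal.coe_le_coe_iff.2 ?_) (hC 1 zero_le_one le_rfl (by simpa using hsmall))
    nlinarith [mul_le_mul_of_nonneg_left hc3' hn0.le]
  push Not at hsmall
  have hη : 0 < η := pos_of_mul_pos_left (zero_lt_one.trans hsmall) hn0.le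
  have hlog := half_sub_logistic_ge (mul_pos hη hk0).le
  by_cases hlarge : 2 ≤ η * k
  · refine le_trans (EReal.coe_le_coe_iff.2 ?_) hA
    have h4 : 1 / 4 ≤ η * k / (2 * (2 + η * k)) := by
      rw [div_le_div_iff₀ (by norm_num) (by positivity)]
      linarith
    have h5 : n / 2 * (k * (1 / 4)) ≤ n / 2 * (k * (1 / 2 - 1 / (1 + Real.exp (η * k)))) := by
      gcongr
      linarith
    nlinarith [mul_le_mul_of_nonneg_left hk4' hn0.le]
  push Not at hlarge
  have h8 : η * k / 8 ≤ η * k / (2 * (2 + η * k)) := by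
    have := mul_pos hη hk0
    gcongr
    linarith
  -- The product of the two lower bounds does not depend on `η`.
  have hprod : T ^ 2 ≤ n / 2 * (k * (η * k / 8)) * (n * (1 / (η * n) * (c * (1 / 4)))) := by
    have : (n / 2 * (k * (η * k / 8)) * (n * (1 / (η * n) * (c * (1 / 4)))) : ℝ) =
        k ^ 2 * c * n / 64 := by
      field_simp
      ring
    rw [this, hTsq]
    nlinarith [mul_le_mul_of_nonneg_right h3' hn0.le]
  rcases le_or_le_of_sq_le_mul (by positivity) hprod with h | h
  · refine le_trans (EReal.coe_le_coe_iff.2 (h.trans ?_)) hA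
    gcongr
    linarith
  · refine le_trans (EReal.coe_le_coe_iff.2 h) (hC _ (by positivity) ?_ ?_)
    · rw [div_le_one (by positivity)]
      exact hsmall.le
    · exact le_of_eq (by field_simp)
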